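/- Let $\mathbb T=\mathbb R/\mathbb Z$ and let $\mathcal C(\mathbb T)$ be the space of continuous complex-valued functions on $\mathbb T$, with the supremum norm. For $f\in\mathcal C(\mathbb T)$ and $n\ge 0$ let $S_nf(x)=\sum_{k=-n}^{n}\hat f(k)e^{2\pi i kx}$, where $\hat f(k)=\int_{\mathbb T}f(t)e^{-2\pi i kt}\,dt$, be the $n$-th partial sum of the Fourier series of $f$. Let $(\delta_n)_{n\ge 2}$ be a sequence of positive real numbers going to zero. Then for quasi-all functions $f\in\mathcal C(\mathbb T)$ (that is, for all $f$ in a residual subset of $\mathcal C(\mathbb T)$, a set containing a countable intersection of dense open sets), there exists a set $E\subset\mathbb T$ with Hausdorff dimension $1$ such that, for every $x\in E$, $$\limsup_{n\to+\infty}\frac{|S_nf(x)|}{\delta_n\log n}=+\infty.$$ -/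

import Mathlib

open Filter Topology

/-- The `n`-th symmetric partial sum `∑_{k=-n}^{n} f̂(k) e^{2πikx}` of the Fourier series of a
continuous function on the circle `ℝ/ℤ`. -/
noncomputable def fourierPartialSum (n : ℕ) (f : C(UnitAddCircle, ℂ)) (x : UnitAddCircle) : ℂ :=
  ∑ k ∈ Finset.Icc (-(n : ℤ)) (n : ℤ), fourierCoeff f k * fourier k x

/-!
The exceptional set can be chosen independently of the function. Fix integers `w k → ∞` with
`w k = o(2 ^ k)` and `δ (4 ^ 2 ^ k) * log (4 ^ 2 ^ k) = o(w k)`, and let `E` be the compact set of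
points `x` with `‖2 ^ 2 ^ k • x‖ ≤ 2 ^ (-w k)` for all `k`. It contains every number whose binary
digits vanish on the blocks `[2 ^ k, 2 ^ k + w k)`; these blocks have density zero, so deleting
them is a map onto `[0, 1]` that is Hölder of every exponent less than `1`, and `dimH E = 1`.

Put `N = 2 ^ 2 ^ k`. A sawtooth of frequency `N`, made smooth by Abel summation and multiplied by
`e(N ^ 2 * x)`, is bounded by `2π`, while its partial sum of order `N ^ 2` retains only one half of
its spectrum. That half is close to `log (1 - r * e(-N * x))` with `r = 1 - 1 / N`, which has size
of order `w k` on all of `E`. Since trigonometric polynomials are dense and have bounded partial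
sums, adding small multiples of these functions to them gives dense open sets, and Baire category
condenses the singularities.
-/

open scoped ENNReal NNReal

/-! ### Spreading binary digits -/

/-- The sum of the signed binary digits `e i`, the `i`-th one placed at position `p i`, that is,
with weight `2 ^ (-(p i + 1))`. -/
noncomputable def spreadDigits (p : ℕ → ℕ) (e : ℕ → ℤ) : ℝ :=
  ∑' i, e i * (1 / 2 : ℝ) ^ (p i + 1)

/-- The integer with binary digits `e 0, …, e (r - 1)`, most significant digit first. -/
def leadingDigits (e : ℕ → ℤ) : ℕ → ℤ
  | 0 => 0
  | r + 1 => 2 * leadingDigits e r + e r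

section SpreadDigits

variable {p : ℕ → ℕ} {e : ℕ → ℤ}

theorem norm_digit_mul_le (he : ∀ i, |e i| ≤ 1) (i : ℕ) :
    ‖e i * (1 / 2 : ℝ) ^ (p i + 1)‖ ≤ (1 / 2 : ℝ) ^ (p i + 1) := by
  have hi : |(e i : ℝ)| ≤ 1 := by exact_mod_cast he i
  rw [norm_mul, Real.norm_eq_abs, Real.norm_of_nonneg (by positivity)]
  exact mul_le_of_le_one_left (by positivity) hi

theorem summable_spreadDigits (hp : StrictMono p) (he : ∀ i, |e i| ≤ 1) :
    Summable fun i => e i * (1 / 2 : ℝ) ^ (p i + 1) :=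
  .of_norm_bounded summable_geometric_two fun i => (norm_digit_mul_le he i).trans <|
    pow_le_pow_of_le_one (by norm_num) (by norm_num) (hp.le_apply.trans (Nat.le_succ _))

theorem abs_spreadDigits_le (hp : StrictMono p) (he : ∀ i, |e i| ≤ 1) :
    |spreadDigits p e| ≤ (1 / 2 : ℝ) ^ p 0 := by
  have hgeom : HasSum (fun i : ℕ => (1 / 2 : ℝ) ^ (p 0 + 1) * (1 / 2 : ℝ) ^ i)
      ((1 / 2 : ℝ) ^ p 0) := by
    have := hasSum_geometric_two.mul_left ((1 / 2 : ℝ) ^ (p 0 + 1))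
    rwa [show (1 / 2 : ℝ) ^ (p 0 + 1) * 2 = (1 / 2) ^ p 0 by ring] at this
  refine tsum_of_norm_bounded hgeom fun i => (norm_digit_mul_le he i).trans ?_
  rw [← pow_add]
  refine pow_le_pow_of_le_one (by norm_num) (by norm_num) ?_
  have := hp.add_le_nat i 0
  rw [add_zero] at this
  omega

theorem abs_spreadDigits_sub_sum_le (hp : StrictMono p) (he : ∀ i, |e i| ≤ 1) (r : ℕ) :
    |spreadDigits p e - ∑ i ∈ Finset.range r, e i * (1 / 2 : ℝ) ^ (p i + 1)|
      ≤ (1 / 2 : ℝ) ^ p r := by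
  have htail := abs_spreadDigits_le (p := fun i => p (i + r)) (e := fun i => e (i + r))
    (fun i j hij => hp (Nat.add_lt_add_right hij r)) fun i => he _
  rw [spreadDigits, ← (summable_spreadDigits hp he).sum_add_tsum_nat_add r, add_sub_cancel_left]
  simpa only [spreadDigits, zero_add] using htail

theorem spreadDigits_sub {b c : ℕ → ℤ} (hp : StrictMono p) (hb : ∀ i, |b i| ≤ 1)
    (hc : ∀ i, |c i| ≤ 1) :
    spreadDigits p b - spreadDigits p c = spreadDigits p fun i => b i - c i := by
  simp only [spreadDigits]
  rw [← (summable_spreadDigits hp hb).tsum_sub (summable_spreadDigits hp hc)]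
  simp only [Int.cast_sub, sub_mul]

theorem sum_range_digits_eq_leadingDigits (e : ℕ → ℤ) (r : ℕ) :
    ∑ i ∈ Finset.range r, e i * (1 / 2 : ℝ) ^ (i + 1) = leadingDigits e r * (1 / 2 : ℝ) ^ r := by
  induction r with
  | zero => simp [leadingDigits]
  | succ r ih =>
    rw [Finset.sum_range_succ, ih, leadingDigits]
    push_cast
    ring

theorem leadingDigits_neg (e : ℕ → ℤ) (r : ℕ) :
    leadingDigits (fun i => -e i) r = -leadingDigits e r := by
  induction r with
  | zero => rfl
  | succ r ih =>
    rw [leadingDigits, leadingDigits, ih]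
    ring

-- If `leadingDigits e r` is nonnegative, so are the shorter ones, because `2 * m + e r ≥ 0` forces
-- `m ≥ 0` for an integer `m`; spreading the digits multiplies these by powers of two.
theorem leadingDigits_mul_le_sum (hp : StrictMono p) (he : ∀ i, |e i| ≤ 1) {r q : ℕ}
    (hq : ∀ i < r, p i < q) (hr : 0 ≤ leadingDigits e r) :
    leadingDigits e r * (1 / 2 : ℝ) ^ q ≤ ∑ i ∈ Finset.range r, e i * (1 / 2 : ℝ) ^ (p i + 1) := by
  induction r generalizing q with
  | zero => simp [leadingDigits]
  | succ r ih =>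
    have hprev : 0 ≤ leadingDigits e r := by
      have := abs_le.1 (he r)
      rw [leadingDigits] at hr
      omega
    have hsum := ih (fun i hi => hp hi) hprev
    calc (leadingDigits e (r + 1) : ℝ) * (1 / 2) ^ q
        ≤ leadingDigits e (r + 1) * (1 / 2) ^ (p r + 1) := by
          refine mul_le_mul_of_nonneg_left ?_ (by exact_mod_cast hr)
          exact pow_le_pow_of_le_one (by norm_num) (by norm_num) (hq r r.lt_succ_self)
      _ = leadingDigits e r * (1 / 2) ^ p r + e r * (1 / 2) ^ (p r + 1) := by
          rw [leadingDigits]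
          push_cast
          ring
      _ ≤ _ := by
          rw [Finset.sum_range_succ]
          gcongr

theorem abs_leadingDigits_mul_le_abs_sum (hp : StrictMono p) (he : ∀ i, |e i| ≤ 1) {r q : ℕ}
    (hq : ∀ i < r, p i < q) :
    |(leadingDigits e r : ℝ)| * (1 / 2 : ℝ) ^ q ≤
      |∑ i ∈ Finset.range r, e i * (1 / 2 : ℝ) ^ (p i + 1)| := by
  rcases le_total 0 (leadingDigits e r) with h | h
  · rw [abs_of_nonneg (by exact_mod_cast h)]
    exact (leadingDigits_mul_le_sum hp he hq h).trans (le_abs_self _)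
  · have hneg := leadingDigits_mul_le_sum (e := fun i => -e i) hp (by simpa only [abs_neg] using he)
      hq (by rw [leadingDigits_neg]; omega)
    rw [abs_of_nonpos (by exact_mod_cast h)]
    simp only [leadingDigits_neg, Int.cast_neg, neg_mul, Finset.sum_neg_distrib] at hneg ⊢
    exact hneg.trans (neg_le_abs _)

theorem abs_spreadDigits_id_le_of_abs_lt (hp : StrictMono p) (he : ∀ i, |e i| ≤ 1) {k : ℕ}
    (hk : |spreadDigits p e| < (1 / 2 : ℝ) ^ (p k + 1)) :
    |spreadDigits id e| ≤ (1 / 2 : ℝ) ^ k := by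
  have hpk : (1 / 2 : ℝ) ^ p (k + 1) ≤ (1 / 2 : ℝ) ^ (p k + 1) :=
    pow_le_pow_of_le_one (by norm_num) (by norm_num) (hp k.lt_succ_self)
  have hlead : |leadingDigits e (k + 1)| ≤ 1 := by
    by_contra! hlarge
    have hlarge' : (2 : ℝ) ≤ |(leadingDigits e (k + 1) : ℝ)| := by exact_mod_cast hlarge
    have hsum := abs_leadingDigits_mul_le_abs_sum hp he (r := k + 1) (q := p k + 1)
      fun i hi => Nat.lt_succ_of_le (hp.monotone (Nat.le_of_lt_succ hi))
    have htail := (abs_sub_abs_le_abs_sub _ _).trans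
      ((abs_sub_comm _ _).trans_le (abs_spreadDigits_sub_sum_le hp he (k + 1)))
    have := mul_le_mul_of_nonneg_right hlarge' (by positivity : (0 : ℝ) ≤ (1 / 2) ^ (p k + 1))
    linarith
  have hlead' : |(leadingDigits e (k + 1) : ℝ)| ≤ 1 := by exact_mod_cast hlead
  have htail := abs_spreadDigits_sub_sum_le strictMono_id he (k + 1)
  simp only [id, sum_range_digits_eq_leadingDigits] at htail
  calc |spreadDigits id e|
      ≤ |(leadingDigits e (k + 1) : ℝ) * (1 / 2) ^ (k + 1)| + (1 / 2) ^ (k + 1) := by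
        linarith [abs_sub_abs_le_abs_sub (spreadDigits id e)
          (leadingDigits e (k + 1) * (1 / 2) ^ (k + 1))]
    _ ≤ 1 * (1 / 2) ^ (k + 1) + (1 / 2) ^ (k + 1) := by
        rw [abs_mul, abs_of_pos (by positivity : (0 : ℝ) < (1 / 2) ^ (k + 1))]
        gcongr
    _ = (1 / 2) ^ k := by ring

theorem abs_spreadDigits_id_le_rpow (hp : StrictMono p) (he : ∀ i, |e i| ≤ 1) {s K : ℝ}
    (hs : 0 ≤ s) (hps : ∀ r, s * p r ≤ r + K) :
    |spreadDigits id e| ≤ 2 ^ (K + s + 1) * |spreadDigits p e| ^ s := by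
  rcases (abs_nonneg (spreadDigits id e)).eq_or_lt with h0 | hpos
  · rw [← h0]
    positivity
  obtain ⟨n, hn, hn'⟩ := exists_nat_pow_near_of_lt_one hpos
    (abs_spreadDigits_le strictMono_id he) one_half_pos one_half_lt_one
  have hfar : (1 / 2 : ℝ) ^ (p (n + 1) + 1) ≤ |spreadDigits p e| :=
    not_lt.1 fun h => hn.not_ge (abs_spreadDigits_id_le_of_abs_lt hp he h)
  have hslope : s * p (n + 1) ≤ n + 1 + K := by exact_mod_cast hps (n + 1)
  have hhalf : ∀ m : ℕ, (1 / 2 : ℝ) ^ m = 2 ^ (-(m : ℝ)) := fun m => by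
    rw [Real.rpow_neg zero_le_two, Real.rpow_natCast, one_div, inv_pow]
  calc |spreadDigits id e| ≤ 2 ^ (-(n : ℝ)) := hhalf n ▸ hn'
    _ ≤ 2 ^ (K + s + 1 + -((p (n + 1) + 1 : ℕ) : ℝ) * s) := by
        refine Real.rpow_le_rpow_of_exponent_le one_le_two ?_
        push_cast
        linarith
    _ = 2 ^ (K + s + 1) * ((1 / 2 : ℝ) ^ (p (n + 1) + 1)) ^ s := by
        rw [hhalf, ← Real.rpow_mul zero_le_two, ← Real.rpow_add two_pos]
    _ ≤ _ := by gcongr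

end SpreadDigits

/-! ### Dyadic approximation and Hausdorff dimension -/

theorem dimH_range_le_of_edist_le {β X Y : Type*} [EMetricSpace X] [EMetricSpace Y] {ψ : β → X}
    {u : β → Y} {C s : ℝ≥0} (hs : 0 < s)
    (h : ∀ b c, edist (u b) (u c) ≤ C * edist (ψ b) (ψ c) ^ (s : ℝ)) :
    dimH (Set.range u) ≤ dimH (Set.range ψ) / s := by
  have hfactor : Set.range u ⊆ Set.range (u ∘ Set.rangeSplitting ψ) := by
    rintro _ ⟨b, rfl⟩
    have hψ := Set.apply_rangeSplitting ψ ⟨ψ b, Set.mem_range_self b⟩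
    refine ⟨⟨ψ b, Set.mem_range_self b⟩, edist_le_zero.1 ((h _ _).trans_eq ?_)⟩
    rw [hψ, edist_self, ENNReal.zero_rpow_of_pos (by exact_mod_cast hs), mul_zero]
  have hholder : HolderWith C s (u ∘ Set.rangeSplitting ψ) := fun y z => by
    simpa only [Function.comp_apply, Set.apply_rangeSplitting, Subtype.edist_eq] using
      h (Set.rangeSplitting ψ y) (Set.rangeSplitting ψ z)
  calc dimH (Set.range u) ≤ dimH (Set.range (u ∘ Set.rangeSplitting ψ)) := dimH_mono hfactor
    _ ≤ dimH (Set.univ : Set (Set.range ψ)) / s := hholder.dimH_range_le hs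
    _ = dimH (Set.range ψ) / s := by
      rw [← isometry_subtype_coe.dimH_image, Set.image_univ, Subtype.range_coe]

theorem dimH_addCircle_le_one {T : ℝ} (E : Set (AddCircle T)) : dimH E ≤ 1 := by
  have hmk : LipschitzWith 1 ((↑) : ℝ → AddCircle T) := .mk_one fun x y => by
    rw [dist_eq_norm, ← AddCircle.coe_sub, Real.dist_eq]
    exact QuotientAddGroup.norm_mk_le_norm
  calc dimH E ≤ dimH (Set.range ((↑) : ℝ → AddCircle T)) :=
        dimH_mono fun x _ => QuotientAddGroup.mk_surjective x
    _ ≤ 1 := hmk.dimH_range_le.trans_eq Real.dimH_univ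

/-- The points `x` of the circle for which `2 ^ a * x` is within `2 ^ (-w)` of an integer: the
norm on `ℝ/ℤ` is the distance to `0`. -/
def nearDyadic (a w : ℕ) : Set UnitAddCircle :=
  {x | ‖2 ^ a • x‖ ≤ (1 / 2 : ℝ) ^ w}

theorem isClosed_nearDyadic (a w : ℕ) : IsClosed (nearDyadic a w) :=
  isClosed_le (continuous_nsmul _).norm continuous_const

theorem exists_int_eq_two_pow_mul_sum_digits {p : ℕ → ℕ} {a r : ℕ} (hp : ∀ i < r, p i < a)
    (e : ℕ → ℤ) :
    ∃ z : ℤ, 2 ^ a * ∑ i ∈ Finset.range r, e i * (1 / 2 : ℝ) ^ (p i + 1) = z := by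
  refine ⟨∑ i ∈ Finset.range r, e i * 2 ^ (a - (p i + 1)), ?_⟩
  push_cast
  rw [Finset.mul_sum]
  refine Finset.sum_congr rfl fun i hi => ?_
  obtain ⟨d, rfl⟩ := Nat.exists_eq_add_of_lt (hp i (Finset.mem_range.1 hi))
  rw [show p i + d + 1 - (p i + 1) = d by omega, show p i + d + 1 = p i + 1 + d by ring, pow_add,
    one_div, inv_pow]
  field_simp

theorem coe_spreadDigits_mem_nearDyadic {p : ℕ → ℕ} {e : ℕ → ℤ} (hp : StrictMono p)
    (he : ∀ i, |e i| ≤ 1) {a w : ℕ} (h : ∀ r, a ≤ p r → a + w ≤ p r) :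
    (spreadDigits p e : UnitAddCircle) ∈ nearDyadic a w := by
  have hex : ∃ r, a ≤ p r := ⟨a, hp.le_apply⟩
  set r := Nat.find hex
  obtain ⟨z, hz⟩ :=
    exists_int_eq_two_pow_mul_sum_digits (fun i hi => not_le.1 (Nat.find_min hex hi)) e
  rw [nearDyadic, Set.mem_ofPred_eq, ← AddCircle.coe_nsmul, UnitAddCircle.norm_eq, nsmul_eq_mul]
  push_cast
  calc |2 ^ a * spreadDigits p e - round (2 ^ a * spreadDigits p e)|
      ≤ |2 ^ a * spreadDigits p e - z| := round_le _ z
    _ = 2 ^ a *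
        |spreadDigits p e - ∑ i ∈ Finset.range r, e i * (1 / 2 : ℝ) ^ (p i + 1)| := by
      rw [← hz, ← mul_sub, abs_mul, abs_of_pos (by positivity)]
    _ ≤ 2 ^ a * (1 / 2 : ℝ) ^ (a + w) := by
      gcongr
      exact (abs_spreadDigits_sub_sum_le hp he r).trans <|
        pow_le_pow_of_le_one (by norm_num) (by norm_num) (h r (Nat.find_spec hex))
    _ = (1 / 2 : ℝ) ^ w := by
      rw [pow_add, ← mul_assoc, ← mul_pow]
      norm_num

/-- The point of the circle whose binary digits are `b i` at position `p i` and `0` elsewhere. -/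
noncomputable def binaryPoint (p : ℕ → ℕ) (b : ℕ → Fin 2) : UnitAddCircle :=
  (spreadDigits p fun i => ((b i : ℕ) : ℤ) : ℝ)

theorem abs_digit_le_one (b : Fin 2) : |((b : ℕ) : ℤ)| ≤ 1 := by
  rw [Nat.abs_cast]
  exact_mod_cast Nat.le_of_lt_succ b.2

theorem spreadDigits_id_eq_ofDigits (b : ℕ → Fin 2) :
    spreadDigits id (fun i => ((b i : ℕ) : ℤ)) = Real.ofDigits b := by
  simp [spreadDigits, Real.ofDigits, Real.ofDigitsTerm]

theorem dist_binaryPoint {p : ℕ → ℕ} (hp : StrictMono p) (hp0 : 0 < p 0) (b c : ℕ → Fin 2) :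
    dist (binaryPoint p b) (binaryPoint p c) =
      |spreadDigits p fun i => ((b i : ℕ) : ℤ) - ((c i : ℕ) : ℤ)| := by
  have hmem : ∀ b : ℕ → Fin 2,
      spreadDigits p (fun i => ((b i : ℕ) : ℤ)) ∈ Set.Icc (0 : ℝ) (1 / 2) := fun b =>
    ⟨tsum_nonneg fun i => by positivity, (le_abs_self _).trans <|
      (abs_spreadDigits_le hp fun i => abs_digit_le_one (b i)).trans <|
        pow_le_of_le_one (by norm_num) (by norm_num) hp0.ne'⟩
  have hb := hmem b
  have hc := hmem c
  rw [dist_eq_norm, binaryPoint, binaryPoint, ← AddCircle.coe_sub,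
    (AddCircle.norm_coe_eq_abs_iff (1 : ℝ) one_ne_zero).2,
    spreadDigits_sub hp (fun i => abs_digit_le_one (b i)) fun i => abs_digit_le_one (c i)]
  rw [abs_one, abs_le]
  constructor <;> linarith [hb.1, hb.2, hc.1, hc.2]

theorem le_dimH_range_binaryPoint {p : ℕ → ℕ} (hp : StrictMono p) (hp0 : 0 < p 0) {s : ℝ≥0}
    (hs : 0 < s) {K : ℝ} (hps : ∀ r, s * p r ≤ r + K) :
    (s : ℝ≥0∞) ≤ dimH (Set.range (binaryPoint p)) := by
  have hdigit : ∀ b c : Fin 2, |((b : ℕ) : ℤ) - ((c : ℕ) : ℤ)| ≤ 1 := by decide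
  have hcontract : ∀ b c : ℕ → Fin 2, edist (Real.ofDigits b) (Real.ofDigits c) ≤
      (2 ^ (K + s + 1) : ℝ≥0) * edist (binaryPoint p b) (binaryPoint p c) ^ (s : ℝ) := by
    intro b c
    rw [edist_dist, edist_dist, ENNReal.ofReal_rpow_of_nonneg dist_nonneg s.coe_nonneg,
      ← ENNReal.ofReal_coe_nnreal, ← ENNReal.ofReal_mul NNReal.zero_le_coe]
    refine ENNReal.ofReal_le_ofReal ?_
    rw [dist_binaryPoint hp hp0, Real.dist_eq, ← spreadDigits_id_eq_ofDigits,
      ← spreadDigits_id_eq_ofDigits, spreadDigits_sub strictMono_id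
        (fun i => abs_digit_le_one (b i)) fun i => abs_digit_le_one (c i)]
    exact abs_spreadDigits_id_le_rpow hp (fun i => hdigit (b i) (c i)) s.coe_nonneg hps
  have hunit : Set.Icc (0 : ℝ) 1 ⊆ Set.range (Real.ofDigits (b := 2)) := fun t ht =>
    Set.image_subset_range _ _ (Real.ofDigits_SurjOn one_lt_two ht)
  have hdim : 1 ≤ dimH (Set.range (binaryPoint p)) / s := by
    rw [← Real.dimH_segment (zero_ne_one (α := ℝ)), segment_eq_Icc zero_le_one]
    exact (dimH_mono hunit).trans (dimH_range_le_of_edist_le hs hcontract)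
  rwa [ENNReal.le_div_iff_mul_le (.inl (by exact_mod_cast hs.ne')) (.inl ENNReal.coe_ne_top),
    one_mul] at hdim

/-- The position `j` lies in none of the blocks `[2 ^ k, 2 ^ k + w k)`. -/
def IsFreePosition (w : ℕ → ℕ) (j : ℕ) : Prop :=
  ∀ k, 2 ^ k ≤ j → 2 ^ k + w k ≤ j

section FreePositions

variable {w : ℕ → ℕ}

theorem count_not_isFreePosition_le [DecidablePred (IsFreePosition w)] {k N : ℕ} (hN : N ≤ 2 ^ k) :
    Nat.count (fun j => ¬IsFreePosition w j) N ≤ ∑ i ∈ Finset.range k, w i := by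
  have hblocks : {j ∈ Finset.range N | ¬IsFreePosition w j} ⊆
      (Finset.range k).biUnion fun i => Finset.Ico (2 ^ i) (2 ^ i + w i) := by
    intro j hj
    rw [Finset.mem_filter, Finset.mem_range] at hj
    obtain ⟨hjN, hj⟩ := hj
    simp only [IsFreePosition, not_forall, not_le] at hj
    obtain ⟨i, hij, hji⟩ := hj
    simp only [Finset.mem_biUnion, Finset.mem_range, Finset.mem_Ico]
    exact ⟨i, (Nat.pow_lt_pow_iff_right one_lt_two).1 (by omega), hij, hji⟩
  rw [Nat.count_eq_card_filter_range]
  simpa only [Nat.card_Ico, Nat.add_sub_cancel_left] using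
    (Finset.card_le_card hblocks).trans Finset.card_biUnion_le

theorem sum_range_isLittleO_two_pow
    (hw : (fun k => (w k : ℝ)) =o[atTop] fun k => (2 : ℝ) ^ k) :
    (fun k => ∑ i ∈ Finset.range k, (w i : ℝ)) =o[atTop] fun k => (2 : ℝ) ^ k := by
  have hsum : ∀ k : ℕ, ∑ i ∈ Finset.range k, (2 : ℝ) ^ i = 2 ^ k - 1 := fun k => by
    rw [geom_sum_eq (by norm_num)]
    norm_num
  have hpow := tendsto_pow_atTop_atTop_of_one_lt (one_lt_two (α := ℝ))
  refine (hw.sum_range (fun k => by positivity) ?_).trans_le fun k => ?_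
  · simpa only [hsum, sub_eq_add_neg] using tendsto_atTop_add_const_right _ (-1) hpow
  · have : (1 : ℝ) ≤ 2 ^ k := one_le_pow₀ one_le_two
    rw [hsum, Real.norm_of_nonneg (by linarith), Real.norm_of_nonneg (by linarith)]
    linarith

theorem exists_mul_le_count_isFreePosition_add [DecidablePred (IsFreePosition w)]
    (hw : (fun k => (w k : ℝ)) =o[atTop] fun k => (2 : ℝ) ^ k) {s : ℝ} (hs : s < 1) :
    ∃ K : ℝ, ∀ N : ℕ, s * N ≤ Nat.count (IsFreePosition w) N + K := by
  obtain ⟨k₀, hk₀⟩ := eventually_atTop.1 <|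
    (sum_range_isLittleO_two_pow hw).bound (show 0 < (1 - s) / 2 by linarith)
  have hblocked : ∀ N : ℕ,
      (Nat.count (fun j => ¬IsFreePosition w j) N : ℝ) ≤ (1 - s) * N + 2 ^ k₀ := by
    intro N
    rcases lt_or_ge N (2 ^ k₀) with hN | hN
    · have hcount : (Nat.count (fun j => ¬IsFreePosition w j) N : ℝ) ≤ 2 ^ k₀ := by
        exact_mod_cast (Nat.count_le _).trans hN.le
      nlinarith [N.cast_nonneg (α := ℝ)]
    · have hN0 : N ≠ 0 := by
        have := Nat.two_pow_pos k₀
        omega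
      have hcount : (Nat.count (fun j => ¬IsFreePosition w j) N : ℝ) ≤
          ∑ i ∈ Finset.range (Nat.log 2 N + 1), (w i : ℝ) := by
        exact_mod_cast count_not_isFreePosition_le (Nat.lt_pow_succ_log_self one_lt_two N).le
      have hsmall := hk₀ (Nat.log 2 N + 1)
        ((Nat.le_log_of_pow_le one_lt_two hN).trans (Nat.le_succ _))
      rw [Real.norm_of_nonneg (by positivity), Real.norm_of_nonneg (by positivity),
        pow_succ] at hsmall
      have hlog : (2 : ℝ) ^ Nat.log 2 N ≤ N := by exact_mod_cast Nat.pow_log_le_self 2 hN0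
      have : (0 : ℝ) < 2 ^ k₀ := by positivity
      nlinarith
  refine ⟨2 ^ k₀, fun N => ?_⟩
  have htotal : (Nat.count (IsFreePosition w) N : ℝ) +
      Nat.count (fun j => ¬IsFreePosition w j) N = N := by
    rw [Nat.count_eq_card_filter_range, Nat.count_eq_card_filter_range]
    exact_mod_cast (Finset.card_filter_add_card_filter_not _).trans (Finset.card_range N)
  linarith [hblocked N]

theorem exists_strictMono_isFreePosition
    (hw : (fun k => (w k : ℝ)) =o[atTop] fun k => (2 : ℝ) ^ k) {s : ℝ} (hs0 : 0 < s)
    (hs1 : s < 1) :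
    ∃ p : ℕ → ℕ, StrictMono p ∧ 0 < p 0 ∧ (∀ r, IsFreePosition w (p r)) ∧
      ∃ K : ℝ, ∀ r, s * p r ≤ r + K := by
  classical
  obtain ⟨K, hK⟩ := exists_mul_le_count_isFreePosition_add hw hs1
  have hinf : (Set.ofPred (IsFreePosition w)).Infinite := fun hfin => by
    obtain ⟨N, hN⟩ := exists_nat_gt ((hfin.toFinset.card + K) / s)
    have hcard : (Nat.count (IsFreePosition w) N : ℝ) ≤ hfin.toFinset.card := by
      exact_mod_cast Nat.count_le_card hfin N
    rw [div_lt_iff₀ hs0] at hN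
    linarith [hK N]
  have hnth := Nat.nth_strictMono hinf
  refine ⟨fun r => Nat.nth (IsFreePosition w) (r + 1), hnth.comp (strictMono_id.add_const 1),
    hnth.le_apply, fun r => Nat.nth_mem_of_infinite hinf _, K + 1, fun r => ?_⟩
  have := hK (Nat.nth (IsFreePosition w) (r + 1))
  rw [Nat.count_nth_of_infinite hinf] at this
  push_cast at this
  linarith

end FreePositions

theorem dimH_iInter_nearDyadic {w : ℕ → ℕ}
    (hw : (fun k => (w k : ℝ)) =o[atTop] fun k => (2 : ℝ) ^ k) :
    dimH (⋂ k, nearDyadic (2 ^ k) (w k)) = 1 := by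
  refine (dimH_addCircle_le_one _).antisymm (ENNReal.le_of_forall_nnreal_lt fun s hs => ?_)
  rcases eq_zero_or_pos s with rfl | hs0
  · exact zero_le
  obtain ⟨p, hp, hp0, hfree, K, hK⟩ := exists_strictMono_isFreePosition hw
    (NNReal.coe_pos.2 hs0) (by exact_mod_cast hs)
  refine (le_dimH_range_binaryPoint hp hp0 hs0 hK).trans (dimH_mono ?_)
  rintro _ ⟨b, rfl⟩
  exact Set.mem_iInter.2 fun k =>
    coe_spreadDigits_mem_nearDyadic hp (fun i => abs_digit_le_one (b i)) fun r => hfree r k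

/-! ### Partial sums of the modulated sawtooth -/

section Fourier

variable {T : ℝ}

theorem norm_fourier_apply (k : ℤ) (x : AddCircle T) : ‖fourier k x‖ = 1 := by
  rw [fourier_apply, Circle.norm_coe]

theorem fourier_mul_natCast (k : ℤ) (j : ℕ) (x : AddCircle T) :
    fourier (k * j) x = fourier k x ^ j := by
  induction j with
  | zero => simp
  | succ j ih => rw [Nat.cast_succ, mul_add, mul_one, fourier_add, ih, pow_succ]

theorem norm_fourier_sub_one_le (k : ℤ) (x : UnitAddCircle) :
    ‖fourier k x - 1‖ ≤ 2 * Real.pi * ‖k • x‖ := by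
  have hlift : ∀ y : ℝ, ‖fourier 1 (y : UnitAddCircle) - 1‖ ≤ 2 * Real.pi * |y| := fun y => by
    have h := Real.norm_exp_I_mul_ofReal_sub_one_le (x := 2 * Real.pi * y)
    rw [norm_mul, Real.norm_of_nonneg Real.two_pi_pos.le, Real.norm_eq_abs] at h
    convert h using 3
    rw [fourier_coe_apply]
    congr 1
    push_cast
    ring
  obtain ⟨y, hy⟩ := QuotientAddGroup.mk_surjective (k • x)
  have hround : ((y - round y : ℝ) : UnitAddCircle) = k • x := by
    rw [AddCircle.coe_sub, ← hy, sub_eq_self, AddCircle.coe_eq_zero_iff]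
    exact ⟨round y, by simp⟩
  have hfourier : fourier k x = fourier 1 ((y - round y : ℝ) : UnitAddCircle) := by
    rw [hround, fourier_apply, fourier_apply, one_zsmul]
  rw [hfourier, ← hy]
  exact (hlift _).trans_eq (by rw [UnitAddCircle.norm_eq])

variable [Fact (0 < T)]

/-- The `k`-th Fourier coefficient as a continuous linear functional on continuous functions: the
inner product with the `k`-th monomial in `L²`. -/
noncomputable def fourierCoeffCLM (k : ℤ) : C(AddCircle T, ℂ) →L[ℂ] ℂ :=
  (innerSL ℂ (fourierLp 2 k)).comp (ContinuousMap.toLp 2 AddCircle.haarAddCircle ℂ)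

theorem fourierCoeffCLM_apply (k : ℤ) (f : C(AddCircle T, ℂ)) :
    fourierCoeffCLM k f = fourierCoeff f k := by
  rw [fourierCoeffCLM, ContinuousLinearMap.comp_apply, innerSL_apply_apply, ← fourierCoeff_toLp,
    ← fourierBasis_repr, HilbertBasis.repr_apply_apply, coe_fourierBasis]

end Fourier

/-- The operator `f ↦ S_n f` on the Banach space of continuous functions. -/
noncomputable def fourierPartialSumCLM (n : ℕ) : C(UnitAddCircle, ℂ) →L[ℂ] C(UnitAddCircle, ℂ) :=
  ∑ k ∈ Finset.Icc (-(n : ℤ)) n, (fourierCoeffCLM k).smulRight (fourier k)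

theorem fourierPartialSumCLM_apply (n : ℕ) (f : C(UnitAddCircle, ℂ)) (x : UnitAddCircle) :
    fourierPartialSumCLM n f x = fourierPartialSum n f x := by
  simp [fourierPartialSumCLM, fourierPartialSum, fourierCoeffCLM_apply]

theorem fourierPartialSum_fourier (n : ℕ) (k : ℤ) (x : UnitAddCircle) :
    fourierPartialSum n (fourier k) x = if |k| ≤ n then fourier k x else 0 := by
  rw [fourierPartialSum, fourierCoeff_fourier]
  simp [Pi.single_apply, abs_le]

theorem exists_bound_fourierPartialSumCLM_of_mem_span {g : C(UnitAddCircle, ℂ)}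
    (hg : g ∈ Submodule.span ℂ (Set.range (@fourier 1))) :
    ∃ B : ℝ, ∀ n x, ‖fourierPartialSumCLM n g x‖ ≤ B := by
  induction hg using Submodule.span_induction with
  | mem f hf =>
    obtain ⟨k, rfl⟩ := hf
    refine ⟨1, fun n x => ?_⟩
    rw [fourierPartialSumCLM_apply, fourierPartialSum_fourier]
    split_ifs
    · rw [norm_fourier_apply]
    · rw [norm_zero]
      exact zero_le_one
  | zero => exact ⟨0, fun n x => by rw [map_zero, ContinuousMap.zero_apply, norm_zero]⟩
  | add f g _ _ hf hg =>
    obtain ⟨A, hA⟩ := hf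
    obtain ⟨B, hB⟩ := hg
    refine ⟨A + B, fun n x => ?_⟩
    rw [map_add]
    exact norm_add_le_of_le (hA n x) (hB n x)
  | smul c f _ hf =>
    obtain ⟨A, hA⟩ := hf
    refine ⟨‖c‖ * A, fun n x => ?_⟩
    rw [map_smul, ContinuousMap.smul_apply, norm_smul]
    exact mul_le_mul_of_nonneg_left (hA n x) (norm_nonneg c)

/-- The function `e(nMx) ∑_{j ≥ 1} (r ^ j / j) (e(njx) - e(-njx))`, where `e(x) = exp(2πix)`: an
Abel-regularised sawtooth of frequency `n`, modulated so that the partial sum of order `nM` keeps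
only the terms with a minus sign. The `j = 0` term of the series vanishes. -/
noncomputable def modulatedSawtooth (n M : ℕ) (r : ℝ) : C(UnitAddCircle, ℂ) :=
  ∑' j : ℕ, ((r : ℂ) ^ j / j) • (fourier (n * (M + j)) - fourier (n * (M - j)))

section ModulatedSawtooth

variable {r : ℝ}

theorem hasSum_modulatedSawtooth (n M : ℕ) (hr : |r| < 1) :
    HasSum (fun j : ℕ => ((r : ℂ) ^ j / j) •
      (fourier (n * (M + j)) - fourier (n * (M - j)) : C(UnitAddCircle, ℂ)))
      (modulatedSawtooth n M r) := by
  refine Summable.hasSum <| .of_norm_bounded (g := fun j : ℕ => |r| ^ j * 2)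
    ((summable_geometric_of_lt_one (abs_nonneg r) hr).mul_right 2) fun j => ?_
  have hcoeff : ‖(r : ℂ) ^ j / j‖ ≤ |r| ^ j := by
    rw [norm_div, norm_pow, Complex.norm_real, Real.norm_eq_abs, Complex.norm_natCast]
    exact div_nat_le_self_of_nonnneg (by positivity) j
  have hdiff : ‖(fourier (n * (M + j)) - fourier (n * (M - j)) : C(UnitAddCircle, ℂ))‖ ≤ 2 :=
    (norm_sub_le _ _).trans_eq (by rw [fourier_norm, fourier_norm, one_add_one_eq_two])
  rw [norm_smul]
  gcongr

theorem norm_mul_fourier_lt_one (hr : |r| < 1) (k : ℤ) (x : UnitAddCircle) :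
    ‖(r : ℂ) * fourier k x‖ < 1 := by
  rwa [norm_mul, norm_fourier_apply, mul_one, Complex.norm_real, Real.norm_eq_abs]

theorem fourier_mul_sub_natCast (n M j : ℕ) (x : UnitAddCircle) :
    fourier (n * (M - j)) x = fourier (n * M) x * fourier (-n) x ^ j := by
  rw [← fourier_mul_natCast, ← fourier_add, mul_sub, sub_eq_add_neg, neg_mul]

theorem modulatedSawtooth_apply (n M : ℕ) (hr : |r| < 1) (x : UnitAddCircle) :
    modulatedSawtooth n M r x = fourier (n * M) x *
      (Complex.log (1 - r * fourier (-n) x) - Complex.log (1 - r * fourier n x)) := by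
  have hlog := fun k : ℤ => Complex.hasSum_taylorSeries_neg_log (norm_mul_fourier_lt_one hr k x)
  have hsum := ((hlog n).sub (hlog (-n))).mul_left (fourier (n * M) x)
  rw [neg_sub_neg] at hsum
  refine (ContinuousMap.hasSum_apply (hasSum_modulatedSawtooth n M hr) x).unique ?_
  refine hsum.congr_fun fun j => ?_
  rw [ContinuousMap.smul_apply, ContinuousMap.sub_apply, fourier_mul_sub_natCast, mul_add,
    fourier_add, fourier_mul_natCast n j, smul_eq_mul]
  ring

theorem norm_log_conj_sub_log_le (z : ℂ) :
    ‖Complex.log (starRingEnd ℂ z) - Complex.log z‖ ≤ 2 * Real.pi := by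
  have hre : (Complex.log (starRingEnd ℂ z) - Complex.log z).re = 0 := by
    rw [Complex.sub_re, Complex.log_re, Complex.log_re, Complex.norm_conj, sub_self]
  rw [← Complex.re_add_im (_ - _), hre, Complex.ofReal_zero, zero_add, norm_mul, Complex.norm_I,
    mul_one, Complex.norm_real, Complex.sub_im, two_mul]
  exact norm_sub_le_of_le (Complex.log_im _ ▸ Complex.abs_arg_le_pi _)
    (Complex.log_im _ ▸ Complex.abs_arg_le_pi _)

theorem norm_modulatedSawtooth_le (n M : ℕ) (hr : |r| < 1) :
    ‖modulatedSawtooth n M r‖ ≤ 2 * Real.pi := by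
  refine (ContinuousMap.norm_le _ Real.two_pi_pos.le).2 fun x => ?_
  have hconj : 1 - r * fourier (-n) x = starRingEnd ℂ (1 - r * fourier n x) := by
    rw [map_sub, map_one, map_mul, Complex.conj_ofReal, fourier_neg]
  rw [modulatedSawtooth_apply n M hr, norm_mul, norm_fourier_apply, one_mul, hconj]
  exact norm_log_conj_sub_log_le _

theorem fourierPartialSumCLM_fourier_sub_fourier {n : ℕ} (hn : 0 < n) (M : ℕ) {j : ℕ} (hj : 0 < j)
    (x : UnitAddCircle) :
    fourierPartialSumCLM (n * M) (fourier (n * (M + j)) - fourier (n * (M - j))) x =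
      if j < 2 * M + 1 then -(fourier (n * M) x * fourier (-n) x ^ j) else 0 := by
  have hle : ∀ m : ℤ, |n * m| ≤ (n * M : ℕ) ↔ |m| ≤ M := fun m => by
    rw [Nat.cast_mul, abs_mul, Nat.abs_cast, mul_le_mul_iff_right₀ (by exact_mod_cast hn)]
  have hplus : ¬|(M + j : ℤ)| ≤ M := by
    rw [abs_le]
    omega
  have hminus : |(M - j : ℤ)| ≤ M ↔ j < 2 * M + 1 := by
    rw [abs_le]
    omega
  rw [map_sub, ContinuousMap.sub_apply, fourierPartialSumCLM_apply, fourierPartialSumCLM_apply,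
    fourierPartialSum_fourier, fourierPartialSum_fourier, fourier_mul_sub_natCast]
  simp only [hle, hplus, hminus, if_false, zero_sub, neg_ite, neg_zero]

theorem logTaylor_neg (n : ℕ) (z : ℂ) :
    Complex.logTaylor n (-z) = -∑ j ∈ Finset.range n, z ^ j / j := by
  rw [Complex.logTaylor, ← Finset.sum_neg_distrib]
  refine Finset.sum_congr rfl fun j _ => ?_
  rw [neg_pow z, ← mul_assoc, ← pow_add, Odd.neg_one_pow ⟨j, by ring⟩, neg_one_mul, neg_div]

theorem fourierPartialSum_modulatedSawtooth {n : ℕ} (hn : 0 < n) (M : ℕ) (hr : |r| < 1)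
    (x : UnitAddCircle) :
    fourierPartialSum (n * M) (modulatedSawtooth n M r) x =
      fourier (n * M) x * Complex.logTaylor (2 * M + 1) (-(r * fourier (-n) x)) := by
  have hterm : ∀ j : ℕ, fourierPartialSumCLM (n * M)
      (((r : ℂ) ^ j / j) • (fourier (n * (M + j)) - fourier (n * (M - j)))) x =
        if j < 2 * M + 1 then
          fourier (n * M) x * -((r * fourier (-n) x) ^ j / j) else 0 := by
    intro j
    rw [map_smul, ContinuousMap.smul_apply]
    rcases j.eq_zero_or_pos with rfl | hj
    · simp
    · rw [fourierPartialSumCLM_fourier_sub_fourier hn M hj, smul_ite, smul_zero, smul_eq_mul]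
      congr 1
      ring
  have hsum := ContinuousMap.hasSum_apply
    ((fourierPartialSumCLM (n * M)).hasSum (hasSum_modulatedSawtooth n M hr)) x
  simp only [hterm] at hsum
  rw [← fourierPartialSumCLM_apply, logTaylor_neg, ← Finset.sum_neg_distrib, Finset.mul_sum]
  exact (hsum.unique <| hasSum_sum_of_ne_finset_zero fun j hj =>
    if_neg (mt Finset.mem_range.2 hj)).trans <|
    Finset.sum_congr rfl fun j hj => if_pos (Finset.mem_range.1 hj)

theorem norm_log_sub_le_norm_fourierPartialSum_modulatedSawtooth {n : ℕ} (hn : 0 < n) (M : ℕ)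
    (hr : |r| < 1) (x : UnitAddCircle) :
    ‖Complex.log (1 - r * fourier (-n) x)‖ - (1 - |r|)⁻¹ / (2 * M + 1) ≤
      ‖fourierPartialSum (n * M) (modulatedSawtooth n M r) x‖ := by
  have hnorm : ‖-((r : ℂ) * fourier (-n) x)‖ = |r| := by
    rw [norm_neg, norm_mul, norm_fourier_apply, mul_one, Complex.norm_real, Real.norm_eq_abs]
  have htail := Complex.norm_log_sub_logTaylor_le (2 * M) (hnorm.trans_lt hr)
  rw [hnorm, ← sub_eq_add_neg] at htail
  push_cast at htail
  have hsmall : |r| ^ (2 * M + 1) * (1 - |r|)⁻¹ / (2 * M + 1) ≤ (1 - |r|)⁻¹ / (2 * M + 1) := by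
    have : 0 ≤ (1 - |r|)⁻¹ := inv_nonneg.2 (sub_nonneg.2 hr.le)
    gcongr
    exact mul_le_of_le_one_left this (pow_le_one₀ (abs_nonneg r) hr.le)
  rw [fourierPartialSum_modulatedSawtooth hn M hr, norm_mul, norm_fourier_apply, one_mul]
  linarith [norm_sub_norm_le (Complex.log (1 - r * fourier (-n) x))
    (Complex.logTaylor (2 * M + 1) (-(r * fourier (-n) x)))]

theorem norm_one_sub_mul_fourier_neg_le (n : ℕ) (hr0 : 0 ≤ r) (hr1 : r ≤ 1) (x : UnitAddCircle) :
    ‖1 - r * fourier (-n) x‖ ≤ 1 - r + 2 * Real.pi * ‖n • x‖ := by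
  have hone : ‖(1 - r : ℂ)‖ = 1 - r := by
    rw [← Complex.ofReal_one, ← Complex.ofReal_sub, Complex.norm_real,
      Real.norm_of_nonneg (sub_nonneg.2 hr1)]
  have hfourier := norm_fourier_sub_one_le (-n) x
  rw [neg_zsmul, norm_neg, natCast_zsmul] at hfourier
  calc ‖1 - r * fourier (-n) x‖ = ‖(1 - r : ℂ) - r * (fourier (-n) x - 1)‖ := by ring_nf
    _ ≤ 1 - r + r * ‖fourier (-n) x - 1‖ := by
      refine (norm_sub_le _ _).trans_eq ?_
      rw [hone, norm_mul, Complex.norm_real, Real.norm_of_nonneg hr0]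
    _ ≤ 1 - r + 1 * (2 * Real.pi * ‖n • x‖) := by gcongr
    _ = 1 - r + 2 * Real.pi * ‖n • x‖ := by rw [one_mul]

end ModulatedSawtooth

theorem neg_log_sub_one_le_norm_fourierPartialSum_modulatedSawtooth {n : ℕ} (hn : 0 < n)
    (x : UnitAddCircle) :
    -Real.log (1 / n + 2 * Real.pi * ‖n • x‖) - 1 ≤
      ‖fourierPartialSum (n * n) (modulatedSawtooth n n (1 - 1 / n)) x‖ := by
  have hn1 : (1 : ℝ) ≤ n := by exact_mod_cast hn
  have hinv : 1 / (n : ℝ) ≤ 1 := div_le_one_of_le₀ hn1 n.cast_nonneg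
  have hinv0 : 0 < 1 / (n : ℝ) := by positivity
  have habs : |1 - 1 / (n : ℝ)| = 1 - 1 / n := abs_of_nonneg (by linarith)
  have hr : |1 - 1 / (n : ℝ)| < 1 := by linarith
  have hsum := norm_log_sub_le_norm_fourierPartialSum_modulatedSawtooth hn n hr x
  have htail : (1 - |1 - 1 / (n : ℝ)|)⁻¹ / (2 * n + 1) ≤ 1 := by
    rw [habs, sub_sub_cancel, one_div, inv_inv]
    exact div_le_one_of_le₀ (by linarith) (by positivity)
  have hclose := norm_one_sub_mul_fourier_neg_le n (r := 1 - 1 / n) (by linarith) (by linarith) x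
  rw [sub_sub_cancel] at hclose
  have hne : 1 - (1 - 1 / n : ℝ) * fourier (-n) x ≠ 0 := fun h =>
    (norm_mul_fourier_lt_one hr (-n) x).ne (by rw [← sub_eq_zero.1 h, norm_one])
  have hlog := Real.log_le_log (norm_pos_iff.2 hne) hclose
  have hre := (neg_le_abs _).trans (Complex.abs_re_le_norm
    (Complex.log (1 - (1 - 1 / n : ℝ) * fourier (-n) x)))
  rw [Complex.log_re] at hre
  linarith

theorem sub_three_mul_log_two_le_norm_fourierPartialSum {a w : ℕ} (hw : w ≤ a) {x : UnitAddCircle}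
    (hx : x ∈ nearDyadic a w) :
    (w - 3) * Real.log 2 - 1 ≤ ‖fourierPartialSum (4 ^ a)
      (modulatedSawtooth (2 ^ a) (2 ^ a) (1 - 1 / (2 ^ a : ℕ))) x‖ := by
  have hsmall : 1 / ((2 ^ a : ℕ) : ℝ) + 2 * Real.pi * ‖2 ^ a • x‖ ≤ 2 ^ 3 * (1 / 2 : ℝ) ^ w := by
    have hnear : ‖2 ^ a • x‖ ≤ (1 / 2 : ℝ) ^ w := hx
    have hinv : 1 / ((2 ^ a : ℕ) : ℝ) ≤ (1 / 2 : ℝ) ^ w := by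
      rw [Nat.cast_pow, Nat.cast_ofNat, ← one_div_pow]
      exact pow_le_pow_of_le_one (by norm_num) (by norm_num) hw
    nlinarith [Real.pi_lt_d2, Real.pi_pos, norm_nonneg (2 ^ a • x)]
  have hlog := Real.log_le_log (by positivity) hsmall
  rw [Real.log_mul (by norm_num) (by positivity), Real.log_pow, Real.log_pow,
    one_div 2, Real.log_inv] at hlog
  have hlarge := neg_log_sub_one_le_norm_fourierPartialSum_modulatedSawtooth
    (Nat.two_pow_pos a) x
  rw [← mul_pow, show 2 * 2 = 4 from rfl] at hlarge
  push_cast at hlog hlarge ⊢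
  linarith

/-! ### Condensation of singularities -/

section Condensation

variable {𝕜 V X F : Type*} [NontriviallyNormedField 𝕜] [SeminormedAddCommGroup V] [NormedSpace 𝕜 V]
  [TopologicalSpace X] [SeminormedAddCommGroup F] [NormedSpace 𝕜 F] {T : ℕ → V →L[𝕜] C(X, F)}
  {E : Set X} {G : Set V} {C : ℝ} {D L : ℕ → ℝ}

theorem isOpen_setOf_forall_lt_norm_apply (hE : IsCompact E) (c : ℝ) (S : V →L[𝕜] C(X, F)) :
    IsOpen {f | ∀ x ∈ E, c < ‖S f x‖} :=
  (ContinuousMap.isOpen_setOfPred_mapsTo hE (isOpen_lt continuous_const continuous_norm)).preimage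
    S.continuous

theorem eventually_lt_mul_sub (hL : Tendsto L atTop atTop) (hD : D =o[atTop] L) {r : ℝ}
    (hr : 0 < r) (B : ℝ) : ∀ᶠ k in atTop, D k < r * L k - B := by
  filter_upwards [hD.bound (half_pos hr), hL.eventually_ge_atTop 0,
    hL.eventually_gt_atTop (B / (r / 2))] with k hDk hLk hB
  rw [div_lt_iff₀ (half_pos hr)] at hB
  rw [Real.norm_of_nonneg hLk] at hDk
  linarith [Real.le_norm_self (D k)]

theorem dense_setOf_frequently_forall_lt_norm_apply (hG : Dense G)
    (hGb : ∀ g ∈ G, ∃ B : ℝ, ∀ k, ∀ x ∈ E, ‖T k g x‖ ≤ B)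
    (hT : ∀ᶠ k in atTop, ∃ h, ‖h‖ ≤ C ∧ ∀ x ∈ E, L k ≤ ‖T k h x‖)
    (hL : Tendsto L atTop atTop) (hD : D =o[atTop] L) (N : ℕ) :
    Dense {f | ∃ k ≥ N, ∀ x ∈ E, D k < ‖T k f x‖} := by
  refine (hG.mono fun g hg => Metric.mem_closure_iff.2 fun ε hε => ?_).of_closure
  obtain ⟨B, hB⟩ := hGb g hg
  obtain ⟨ρ, hρ0, hρ⟩ := NormedField.exists_norm_lt 𝕜 (show 0 < ε / (|C| + 1) by positivity)
  rw [lt_div_iff₀ (by positivity)] at hρ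
  obtain ⟨k, ⟨h, hhC, hhL⟩, hDk, hkN⟩ :=
    (hT.and ((eventually_lt_mul_sub hL hD hρ0 B).and (eventually_ge_atTop N))).exists
  refine ⟨g + ρ • h, ⟨k, hkN, fun x hx => hDk.trans_le ?_⟩, ?_⟩
  · calc ‖ρ‖ * L k - B ≤ ‖ρ‖ * ‖T k h x‖ - ‖T k g x‖ := by
          gcongr
          exacts [hhL x hx, hB k x hx]
      _ ≤ ‖T k (g + ρ • h) x‖ := by
          rw [map_add, map_smul, ContinuousMap.add_apply, ContinuousMap.smul_apply, add_comm,
            ← norm_smul, ← norm_neg (T k g x)]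
          exact (norm_sub_norm_le _ _).trans_eq (by rw [sub_neg_eq_add])
  · calc dist g (g + ρ • h) = ‖ρ‖ * ‖h‖ := by rw [dist_self_add_right, norm_smul]
      _ ≤ ‖ρ‖ * (|C| + 1) := by
        gcongr
        linarith [le_abs_self C]
      _ < ε := hρ

theorem eventually_residual_frequently_forall_lt_norm_apply (hE : IsCompact E) (hG : Dense G)
    (hGb : ∀ g ∈ G, ∃ B : ℝ, ∀ k, ∀ x ∈ E, ‖T k g x‖ ≤ B)
    (hT : ∀ᶠ k in atTop, ∃ h, ‖h‖ ≤ C ∧ ∀ x ∈ E, L k ≤ ‖T k h x‖)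
    (hL : Tendsto L atTop atTop) (hD : D =o[atTop] L) :
    ∀ᶠ f in residual V, ∃ᶠ k in atTop, ∀ x ∈ E, D k < ‖T k f x‖ := by
  simp only [frequently_atTop]
  refine eventually_countable_forall.2 fun N => residual_of_dense_open ?_
    (dense_setOf_frequently_forall_lt_norm_apply hG hGb hT hL hD N)
  have hunion : {f | ∃ k ≥ N, ∀ x ∈ E, D k < ‖T k f x‖} =
      ⋃ k ≥ N, {f | ∀ x ∈ E, D k < ‖T k f x‖} := by
    ext f
    simp
  exact hunion ▸ isOpen_biUnion fun k _ => isOpen_setOf_forall_lt_norm_apply hE (D k) (T k)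

end Condensation

theorem exists_norm_le_half_le_norm_fourierPartialSumCLM {a w : ℕ} (hw : 17 ≤ w) (hwa : w ≤ a) :
    ∃ h : C(UnitAddCircle, ℂ), ‖h‖ ≤ 2 * Real.pi ∧
      ∀ x ∈ nearDyadic a w, (w / 2 : ℝ) ≤ ‖fourierPartialSumCLM (4 ^ a) h x‖ := by
  refine ⟨_, norm_modulatedSawtooth_le (2 ^ a) (2 ^ a) (r := 1 - 1 / (2 ^ a : ℕ)) ?_,
    fun x hx => ?_⟩
  · have hpos : 0 < 1 / ((2 ^ a : ℕ) : ℝ) := by positivity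
    have hle : 1 / ((2 ^ a : ℕ) : ℝ) ≤ 1 :=
      div_le_one_of_le₀ (by exact_mod_cast Nat.one_le_two_pow) (Nat.cast_nonneg _)
    rw [abs_of_nonneg] <;> linarith
  · have hw' : (17 : ℝ) ≤ w := by exact_mod_cast hw
    have hlarge := sub_three_mul_log_two_le_norm_fourierPartialSum hwa hx
    rw [fourierPartialSumCLM_apply]
    nlinarith [Real.log_two_gt_d9]

theorem dense_span_fourier {T : ℝ} [Fact (0 < T)] :
    Dense (Submodule.span ℂ (Set.range (@fourier T)) : Set C(AddCircle T, ℂ)) :=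
  Submodule.dense_iff_topologicalClosure_eq_top.2 span_fourier_closure_eq_top

theorem eventually_residual_frequently_lt_norm_fourierPartialSum {a w : ℕ → ℕ} {D : ℕ → ℝ}
    (hw : Tendsto w atTop atTop) (hwa : ∀ᶠ k in atTop, w k ≤ a k)
    (hD : D =o[atTop] fun k => (w k : ℝ)) :
    ∀ᶠ f in residual C(UnitAddCircle, ℂ), ∃ᶠ k in atTop,
      ∀ x ∈ ⋂ k, nearDyadic (a k) (w k), D k < ‖fourierPartialSum (4 ^ a k) f x‖ := by
  simp only [← fourierPartialSumCLM_apply]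
  refine eventually_residual_frequently_forall_lt_norm_apply (C := 2 * Real.pi)
    (L := fun k => (w k : ℝ) / 2) (isClosed_iInter fun k => isClosed_nearDyadic _ _).isCompact
    dense_span_fourier (fun g hg => ?_) ?_ ?_ ?_
  · obtain ⟨B, hB⟩ := exists_bound_fourierPartialSumCLM_of_mem_span hg
    exact ⟨B, fun k x _ => hB _ x⟩
  · filter_upwards [hwa, hw.eventually_ge_atTop 17] with k hwak hwk
    obtain ⟨h, hh, hhx⟩ := exists_norm_le_half_le_norm_fourierPartialSumCLM hwk hwak
    exact ⟨h, hh, fun x hx => hhx x (Set.mem_iInter.1 hx k)⟩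
  · exact (tendsto_natCast_atTop_atTop.comp hw).atTop_div_const two_pos
  · simp only [div_eq_inv_mul]
    exact (Asymptotics.isLittleO_const_mul_right_iff (by norm_num)).2 hD

section Growth

variable {α : Type*} {l : Filter α}

theorem isLittleO_sqrt_mul {s v : α → ℝ} (hs : 0 ≤ s) (hv : 0 ≤ v) (h : s =o[l] v) :
    s =o[l] (fun k => √(s k * v k)) ∧ (fun k => √(s k * v k)) =o[l] v := by
  have hsq : (fun k => √(s k * v k)) ^ 2 = s * v :=
    funext fun k => Real.sq_sqrt (mul_nonneg (hs k) (hv k))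
  refine ⟨.of_pow (n := 2) ?_ two_ne_zero, .of_pow (n := 2) ?_ two_ne_zero⟩ <;> rw [hsq, sq]
  · exact (Asymptotics.isBigO_refl s l).mul_isLittleO h
  · exact h.mul_isBigO (Asymptotics.isBigO_refl v l)

theorem exists_nat_isLittleO_between {u v : α → ℝ} (hv : 0 ≤ v) (hlim : Tendsto v l atTop)
    (h : u =o[l] v) :
    ∃ w : α → ℕ, Tendsto w l atTop ∧ u =o[l] (fun k => (w k : ℝ)) ∧
      (fun k => (w k : ℝ)) =o[l] v := by
  have hone : (fun _ => (1 : ℝ)) =o[l] v :=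
    (Asymptotics.isLittleO_one_left_iff ℝ).2 (tendsto_norm_atTop_atTop.comp hlim)
  have hs0 : ∀ k, 0 ≤ ‖u k‖ + 1 := fun k => by positivity
  obtain ⟨hleft, hright⟩ := isLittleO_sqrt_mul hs0 hv (h.norm_left.add hone)
  have htop : Tendsto (fun k => √((‖u k‖ + 1) * v k)) l atTop := by
    refine Real.tendsto_sqrt_atTop.comp (tendsto_atTop_mono (fun k => ?_) hlim)
    exact le_mul_of_one_le_left (hv k) (le_add_of_nonneg_left (norm_nonneg _))
  have hceil := (Asymptotics.isEquivalent_nat_ceil (R := ℝ)).comp_tendsto htop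
  have hu : u =O[l] fun k => ‖u k‖ + 1 := .of_norm_le fun k => le_add_of_nonneg_right zero_le_one
  exact ⟨fun k => ⌈√((‖u k‖ + 1) * v k)⌉₊, tendsto_nat_ceil_atTop.comp htop,
    hu.trans_isLittleO (hleft.trans_isBigO hceil.isBigO_symm), hceil.isBigO.trans_isLittleO hright⟩

theorem limsup_coe_eq_top_of_frequently {u : α → ℝ} (h : ∀ j : ℕ, ∃ᶠ n in l, j < u n) :
    limsup (fun n => (u n : EReal)) l = ⊤ := by
  refine (EReal.eq_top_iff_forall_lt _).2 fun y => ?_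
  obtain ⟨j, hj⟩ := exists_nat_gt y
  calc (y : EReal) < (j : ℝ) := EReal.coe_lt_coe_iff.2 hj
    _ ≤ _ := le_limsup_of_frequently_le ((h j).mono fun n hn => EReal.coe_le_coe_iff.2 hn.le)

end Growth

theorem isLittleO_mul_log_natCast_pow {δ : ℕ → ℝ} (hδ : Tendsto δ atTop (𝓝 0)) {b : ℕ} (hb : 1 < b)
    {a : ℕ → ℕ} (ha : Tendsto a atTop atTop) :
    (fun k => δ (b ^ a k) * Real.log (b ^ a k : ℕ)) =o[atTop] fun k => (a k : ℝ) := by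
  have hlog : (fun k => Real.log (b ^ a k : ℕ)) =O[atTop] fun k => (a k : ℝ) := by
    simp only [Nat.cast_pow, Real.log_pow, mul_comm _ (Real.log b)]
    exact Asymptotics.isBigO_const_mul_self _ _ _
  have hzero : (fun k => δ (b ^ a k)) =o[atTop] fun _ => (1 : ℝ) :=
    (Asymptotics.isLittleO_one_iff ℝ).2
      (hδ.comp ((tendsto_pow_atTop_atTop_of_one_lt hb).comp ha))
  simpa only [one_mul] using hzero.mul_isBigO hlog

theorem theorem5_general (δ : ℕ → ℝ) (hδ_pos : ∀ n, 2 ≤ n → 0 < δ n)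
    (hδ_lim : Tendsto δ atTop (𝓝 0)) :
    ∃ E : Set UnitAddCircle, IsCompact E ∧ dimH E = 1 ∧
      ∀ᶠ f in residual C(UnitAddCircle, ℂ), ∀ x ∈ E,
        limsup (fun n : ℕ =>
          ((‖fourierPartialSum n f x‖ / (δ n * Real.log n) : ℝ) : EReal)) atTop = ⊤ := by
  have htwo : Tendsto (fun k : ℕ => 2 ^ k) atTop atTop :=
    tendsto_pow_atTop_atTop_of_one_lt one_lt_two
  obtain ⟨w, hw, hδw, hw2⟩ := exists_nat_isLittleO_between (fun k => Nat.cast_nonneg _)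
    (tendsto_natCast_atTop_atTop.comp htwo)
    (isLittleO_mul_log_natCast_pow hδ_lim (show 1 < 4 by norm_num) htwo)
  refine ⟨⋂ k, nearDyadic (2 ^ k) (w k),
    (isClosed_iInter fun k => isClosed_nearDyadic _ _).isCompact,
    dimH_iInter_nearDyadic (by simpa only [Nat.cast_pow, Nat.cast_ofNat] using hw2), ?_⟩
  have hw_le : ∀ᶠ k in atTop, w k ≤ 2 ^ k :=
    hw2.eventuallyLE.mono fun k hk => by simpa only [Real.norm_natCast, Nat.cast_le] using hk
  have hres := eventually_countable_forall.2 fun j : ℕ =>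
    eventually_residual_frequently_lt_norm_fourierPartialSum hw hw_le (hδw.const_mul_left j)
  refine hres.mono fun f hf x hx => limsup_coe_eq_top_of_frequently fun j => ?_
  have hfour : Tendsto (fun k => 4 ^ 2 ^ k) atTop atTop :=
    (tendsto_pow_atTop_atTop_of_one_lt (show 1 < 4 by norm_num)).comp htwo
  refine hfour.frequently ((hf j).mono fun k hk => (lt_div_iff₀ ?_).2 (hk x hx))
  have htwo_le : 2 ≤ 4 ^ 2 ^ k :=
    (show 2 ≤ 4 by norm_num).trans (Nat.le_self_pow (Nat.two_pow_pos k).ne' 4)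
  exact mul_pos (hδ_pos _ htwo_le) (Real.log_pos (by exact_mod_cast htwo_le))

theorem theorem5 (δ : ℕ → ℝ) (hδ_pos : ∀ n, 2 ≤ n → 0 < δ n)
    (hδ_lim : Tendsto δ atTop (𝓝 0)) :
    ∀ᶠ f in residual C(UnitAddCircle, ℂ),
      ∃ E : Set UnitAddCircle, dimH E = 1 ∧
        ∀ x ∈ E,
          limsup (fun n : ℕ =>
            ((‖fourierPartialSum n f x‖ / (δ n * Real.log n) : ℝ) : EReal)) atTop = ⊤ := by
  obtain ⟨E, -, hdim, hE⟩ := theorem5_general δ hδ_pos hδ_lim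
  exact hE.mono fun f hf => ⟨E, hdim, hf⟩
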